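/- **Setting.** Let $\mathcal V_1,\mathcal V_2$ be finite-dimensional real normed spaces and let $\mathcal X_i\subset\mathcal V_i$ ($i=1,2$) be compact convex sets. Put $\mathcal V=\mathcal V_1\times\mathcal V_2$ with the norm $\|x\|^2=\|x_1\|^2+\|x_2\|^2$, let $\mathcal V^*$ be its dual with the dual norm $\|\cdot\|_*$, and put $\mathcal X=\mathcal X_1\times\mathcal X_2$. Let $f$ be a real function that is $C^1$ on a neighbourhood of $\mathcal X$, and let $g(x)=(\nabla_{x_1}f(x),-\nabla_{x_2}f(x))\in\mathcal V^*$. A solution of the problem $\min_{x_1\in\mathcal X_1}\max_{x_2\in\mathcal X_2}f(x_1,x_2)$ is a saddle point, i.e. a point $x^*\in\mathcal X$ with $f(x_1^*,x_2)\le f(x_1^*,x_2^*)\le f(x_1,x_2^*)$ for all $x\in\mathcal X$; assume that at least one exists. The problem is *coherent* if a point $x^*\in\mathcal X$ is a saddle point if and only if $\langle g(x),x-x^*\rangle\ge 0$ for all $x\in\mathcal X$; it is *strictly coherent* if, in addition, $\langle g(x),x-x^*\rangle>0$ for every saddle point $x^*$ and every $x\in\mathcal X$ that is not a saddle point. Let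 $h:\mathcal X\to\mathbb R$ be continuous and $K$-strongly convex for some $K>0$, i.e. $h(tx+(1-t)x')\le th(x)+(1-t)h(x')-\tfrac K2t(1-t)\|x-x'\|^2$ for $x,x'\in\mathcal X$, $t\in[0,1]$. Let $\partial h(x)=\{y\in\mathcal V^*: h(x')\ge h(x)+\langle y,x'-x\rangle\ \forall x'\in\mathcal X\}$ for $x\in\mathcal X$, let $\operatorname{dom}\partial h=\{x\in\mathcal X:\partial h(x)\ne\varnothing\}$, and suppose that $\partial h$ has a continuous selection $\nabla h:\operatorname{dom}\partial h\to\mathcal V^*$. Write $D(p,x)=h(p)-h(x)-\langle\nabla h(x),p-x\rangle$ for the Bregman divergence ($p\in\mathcal X$, $x\in\operatorname{dom}\partial h$), assume Bregman reciprocity ($D(p,x_n)\to0$ whenever $p\in\mathcal X$, $x_n\in\operatorname{dom}\partial h$ and $x_n\to p$), and let $P_x(y)=\operatorname{argmin}_{x'\in\mathcal X}\{\langle y,x-x'\rangle+D(x',x)\}$ be the prox-mapping. On a probability space, optimistic mirror descent is the recursion $$X_{n+1/2}=P_{X_n}(-\gamma_n\hat g_n),\qquad X_{n+1}=P_{X_n}(-\gamma_n\hat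 g_{n+1/2}),\qquad n=1,2,\dots,$$ with step-sizes $\gamma_n>0$ and with $X_1$ arbitrary in $\operatorname{dom}\partial h$, where the oracle signals $\hat g_n,\hat g_{n+1/2}$ are $\mathcal V^*$-valued random variables such that, for some finite constant $G$ and all $n$, $$\mathbb E[\hat g_n\mid\mathcal F_n]=g(X_n),\quad \mathbb E[\|\hat g_n\|_*^2\mid\mathcal F_n]\le G^2,\qquad \mathbb E[\hat g_{n+1/2}\mid\mathcal F_{n+1/2}]=g(X_{n+1/2}),\quad \mathbb E[\|\hat g_{n+1/2}\|_*^2\mid\mathcal F_{n+1/2}]\le G^2$$ almost surely, with $\mathcal F_n=\sigma(X_1,\dots,X_n)$ and $\mathcal F_{n+1/2}=\sigma(X_1,\dots,X_n,X_{n+1/2})$. **Theorem.** Suppose that the saddle-point problem is strictly coherent and that optimistic mirror descent is run as above with step-sizes such that $\sum_n\gamma_n=\infty$ and $\sum_n\gamma_n^2<\infty$. Then, with probability $1$, $X_n$ converges to a (possibly random) solution of the saddle-point problem. -/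

import Mathlib

open MeasureTheory Filter Topology Set

namespace OMD

/-- The ambient space `V₁ × V₂` with the product norm `‖x‖² = ‖x₁‖² + ‖x₂‖²`. -/
abbrev Space (V₁ V₂ : Type*) : Type _ := WithLp 2 (V₁ × V₂)

section SaddlePoints

variable {V₁ V₂ : Type*} [NormedAddCommGroup V₁] [NormedSpace ℝ V₁]
  [NormedAddCommGroup V₂] [NormedSpace ℝ V₂]

/-- The feasible region `C₁ × C₂`, as a subset of the ambient space. -/
def feasible (C₁ : Set V₁) (C₂ : Set V₂) : Set (Space V₁ V₂) :=
  {x | x.fst ∈ C₁ ∧ x.snd ∈ C₂}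

/-- `p` is a solution of `min_{x₁ ∈ C₁} max_{x₂ ∈ C₂} f x₁ x₂`, i.e. a feasible saddle point:
`f p₁ x₂ ≤ f x₁ p₂` for all `x₁ ∈ C₁`, `x₂ ∈ C₂`, equivalently
`f p₁ x₂ ≤ f p₁ p₂ ≤ f x₁ p₂`. -/
def IsSaddle (f : V₁ → V₂ → ℝ) (C₁ : Set V₁) (C₂ : Set V₂) (p : Space V₁ V₂) : Prop :=
  p ∈ feasible C₁ C₂ ∧ IsSaddlePointOn C₁ C₂ f p.fst p.snd

/-- The covector `g(x) = (∇_{x₁} f(x), -∇_{x₂} f(x))` in the dual of the ambient space. -/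
noncomputable def gradField (f : V₁ → V₂ → ℝ) (x : Space V₁ V₂) : StrongDual ℝ (Space V₁ V₂) :=
  (fderiv ℝ (fun u => f u x.snd) x.fst).comp (WithLp.fstL 2 ℝ V₁ V₂)
    - (fderiv ℝ (fun w => f x.fst w) x.snd).comp (WithLp.sndL 2 ℝ V₁ V₂)

/-- `p` solves the Minty variational inequality
`⟨g(x), x - p⟩ ≥ 0` for all feasible `x`. -/
def IsVISolution (f : V₁ → V₂ → ℝ) (C₁ : Set V₁) (C₂ : Set V₂) (p : Space V₁ V₂) : Prop :=
  p ∈ feasible C₁ C₂ ∧ ∀ x ∈ feasible C₁ C₂, 0 ≤ gradField f x (x - p)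

/-- The saddle-point problem is coherent: its solutions are exactly the solutions of the
associated variational inequality. -/
def Coherent (f : V₁ → V₂ → ℝ) (C₁ : Set V₁) (C₂ : Set V₂) : Prop :=
  ∀ p : Space V₁ V₂, IsSaddle f C₁ C₂ p ↔ IsVISolution f C₁ C₂ p

/-- The saddle-point problem is strictly coherent: it is coherent, and the variational inequality
is strict whenever `x` is not a saddle point. -/
def StrictlyCoherent (f : V₁ → V₂ → ℝ) (C₁ : Set V₁) (C₂ : Set V₂) : Prop :=
  Coherent f C₁ C₂ ∧
    ∀ p : Space V₁ V₂, IsSaddle f C₁ C₂ p → ∀ x ∈ feasible C₁ C₂, ¬ IsSaddle f C₁ C₂ x →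
      0 < gradField f x (x - p)

end SaddlePoints

section Bregman

variable {V : Type*} [NormedAddCommGroup V] [NormedSpace ℝ V]

/-- The subdifferential at `x ∈ C` of a function `h : C → ℝ` (extended by `+∞` outside `C`). -/
def subdiff (C : Set V) (h : V → ℝ) (x : V) : Set (StrongDual ℝ V) :=
  {y | ∀ x' ∈ C, h x + y (x' - x) ≤ h x'}

/-- The domain of the subdifferential of `h : C → ℝ`. -/
def domSubdiff (C : Set V) (h : V → ℝ) : Set V :=
  {x | x ∈ C ∧ (subdiff C h x).Nonempty}

/-- `h` is a `K`-strongly convex distance-generating function on `C`, and `dh` is a continuous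
selection of its subdifferential. -/
structure IsDGF (C : Set V) (K : ℝ) (h : V → ℝ) (dh : V → StrongDual ℝ V) : Prop where
  modulus_pos : 0 < K
  continuousOn : ContinuousOn h C
  strongConvexOn : StrongConvexOn C K h
  selection_continuousOn : ContinuousOn dh (domSubdiff C h)
  selection_mem : ∀ x ∈ domSubdiff C h, dh x ∈ subdiff C h x

/-- The Bregman divergence `D(p, x) = h(p) - h(x) - ⟨∇h(x), p - x⟩`. -/
def bregman (h : V → ℝ) (dh : V → StrongDual ℝ V) (p x : V) : ℝ :=
  h p - h x - dh x (p - x)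

/-- Bregman reciprocity: `D(p, xₙ) → 0` whenever `xₙ → p`. -/
def BregmanReciprocity (C : Set V) (h : V → ℝ) (dh : V → StrongDual ℝ V) : Prop :=
  ∀ p ∈ C, ∀ x : ℕ → V, (∀ n, x n ∈ domSubdiff C h) → Tendsto x atTop (𝓝 p) →
    Tendsto (fun n => bregman h dh p (x n)) atTop (𝓝 0)

/-- `x'` is the value at `y` of the prox-mapping with base point `x`:
`x' = argmin_{z ∈ C} { ⟨y, x - z⟩ + D(z, x) }`. -/
def IsProx (C : Set V) (h : V → ℝ) (dh : V → StrongDual ℝ V) (x : V) (y : StrongDual ℝ V)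
    (x' : V) : Prop :=
  x' ∈ C ∧ IsMinOn (fun z => y (x - z) + bregman h dh z x) C x'

end Bregman

section Stochastic

variable {Ω V : Type*} [TopologicalSpace V]

/-- The history `σ(X₀, …, Xₙ)` of the states up to stage `n` (inclusive). -/
abbrev history (X : ℕ → Ω → V) (n : ℕ) : MeasurableSpace Ω :=
  ⨆ i ≤ n, MeasurableSpace.comap (X i) (borel V)

/-- The history `σ(X₀, …, Xₙ, X_{n+1/2})` up to the intermediate stage `n + 1/2` (inclusive);
`Y n` stands for `X_{n+1/2}`. -/
abbrev halfHistory (X Y : ℕ → Ω → V) (n : ℕ) : MeasurableSpace Ω :=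
  history X n ⊔ MeasurableSpace.comap (Y n) (borel V)

end Stochastic

/-- `X n`, `Y n` (standing for `X_{n+1/2}`) are the iterates of optimistic mirror descent with
step-sizes `γ n`, gradient signals `u n` at `X n` and `v n` at `X_{n+1/2}`, and an arbitrary
initial state in the domain of the subdifferential of `h`. -/
structure IsOMD {Ω V : Type*} [NormedAddCommGroup V] [NormedSpace ℝ V]
    (C : Set V) (h : V → ℝ) (dh : V → StrongDual ℝ V) (γ : ℕ → ℝ)
    (X Y : ℕ → Ω → V) (u v : ℕ → Ω → StrongDual ℝ V) : Prop where
  init : ∀ ω, X 0 ω ∈ domSubdiff C h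
  half_step : ∀ n ω, IsProx C h dh (X n ω) (-(γ n • u n ω)) (Y n ω)
  step : ∀ n ω, IsProx C h dh (X n ω) (-(γ n • v n ω)) (X (n + 1) ω)

/-- A signal `u` about the value `g(Z)` given the information `m`: square-integrable, unbiased
`E[u | m] = g(Z)`, and with conditional mean square `E[‖u‖² | m] ≤ G²`, where `‖·‖` is the
dual norm. -/
structure IsOracleSignal {Ω V : Type*} [NormedAddCommGroup V] [NormedSpace ℝ V]
    {m0 : MeasurableSpace Ω} (P : Measure Ω) (m : MeasurableSpace Ω)
    (g : V → StrongDual ℝ V) (G : ℝ) (Z : Ω → V) (u : Ω → StrongDual ℝ V) : Prop where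
  memLp : MemLp u 2 P
  unbiased : P[u | m] =ᵐ[P] fun ω => g (Z ω)
  meanSquare : P[fun ω => ‖u ω‖ ^ 2 | m] ≤ᵐ[P] fun _ => G ^ 2

end OMD

namespace OMD

/-! ### Convex analysis: Bregman divergences and the prox-mapping. -/

section Deterministic

variable {V : Type*} [NormedAddCommGroup V] [NormedSpace ℝ V]
  {C : Set V} {h : V → ℝ} {dh : V → StrongDual ℝ V} {K : ℝ}

/-! For a fixed solution `p`, the divergence `D(p, Xₙ)` is a stochastic Lyapunov function. One step
lowers it by `γₙ⟨vₙ, Yₙ - p⟩` up to an error of order `γₙ²(‖uₙ‖² + ‖vₙ‖²)` (`bregman_step_le`). The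
expectation of `vₙ` given the half-history is `g(Yₙ)`, and `⟨g(Yₙ), Yₙ - p⟩ ≥ 0`. So `D(p, Xₙ)`,
once normalized, is an almost supermartingale with summable errors: almost surely it converges and
`∑ γₙ⟨g(Yₙ), Yₙ - p⟩ < ∞` (`IsOMD.ae_tendsto_bregman_and_summable`).

As `∑ γₙ = ∞`, the pairings tend to zero along a subsequence. Compactness and strict coherence make
some limit point `p` of `Yₙ` a solution, and `Xₙ - Yₙ → 0`. Reciprocity gives `D(p, Xₙ) → 0` along
that subsequence, hence along the whole sequence, and strong convexity gives `Xₙ → p`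
(`tendsto_of_bregman_tendsto_of_summable`).

This limit is random, so the divergences must converge for all solutions outside one null set.
Differences of divergences are governed by the linear functionals `∇h(Xₙ)`, so finitely many
solutions suffice (`exists_finite_forall_tendsto_bregman`).

At boundary points a prox step yields a subgradient other than `∇h`; `IsDGF.le_selection` shows that
the exchange goes in the favourable direction. -/

lemma le_of_forall_le_add_mul {a b c : ℝ} (H : ∀ t : ℝ, 0 < t → t ≤ 1 → a ≤ b + t * c) :
    a ≤ b := by
  have h1 : Tendsto (fun t : ℝ => b + t * c) (𝓝[>] 0) (𝓝 (b + 0 * c)) :=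
    ((continuous_const.add (continuous_id.mul continuous_const)).tendsto 0).mono_left
      nhdsWithin_le_nhds
  rw [zero_mul, add_zero] at h1
  refine ge_of_tendsto h1 ?_
  filter_upwards [Ioc_mem_nhdsGT (zero_lt_one' ℝ)] with t ht using H t ht.1 ht.2

/-- The minimizer of a convex function plus a multiple of a Euclidean squared distance belongs to
the domain of the subdifferential. -/
lemma mem_domSubdiff_of_isMinOn {E : Type*} [NormedAddCommGroup E] [InnerProductSpace ℝ E]
    (hh : ConvexOn ℝ C h) (e : V →L[ℝ] E) (c : V) (k : ℝ) {z : V} (hz : z ∈ C)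
    (hmin : IsMinOn (fun z => h z + k * ‖e (z - c)‖ ^ 2) C z) : z ∈ domSubdiff C h := by
  -- The subgradient is minus the derivative of the quadratic term at `z`.
  refine ⟨hz, -((2 * k) • (innerSL ℝ (e (z - c))).comp e), fun x hx => ?_⟩
  refine le_of_forall_le_add_mul (c := k * ‖e (x - z)‖ ^ 2) fun t ht ht1 => ?_
  have h1 := hh.2 hz hx (sub_nonneg.2 ht1) ht.le (by ring)
  have hmem := hh.1 hz hx (sub_nonneg.2 ht1) ht.le (by ring)
  have h2 : h z + k * ‖e (z - c)‖ ^ 2 ≤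
      h ((1 - t) • z + t • x) + k * ‖e ((1 - t) • z + t • x - c)‖ ^ 2 := hmin hmem
  have h3 : e (((1 - t) • z + t • x) - c) = e (z - c) + t • e (x - z) := by
    rw [← map_smul, ← map_add]; congr 1; module
  simp only [smul_eq_mul] at h1
  rw [h3, norm_add_sq_real, norm_smul, inner_smul_right, Real.norm_of_nonneg ht.le] at h2
  have h4 : t * (h z) ≤ t * (h x + 2 * k * inner ℝ (e (z - c)) (e (x - z))
      + t * (k * ‖e (x - z)‖ ^ 2)) := by nlinarith
  have h5 := le_of_mul_le_mul_left h4 ht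
  simp only [neg_apply, smul_apply,
    ContinuousLinearMap.comp_apply, innerSL_apply_apply, smul_eq_mul]
  linarith

/-- Density of the domain: a steep penalty forces the minimizer close to `c`. The penalty uses
Euclidean coordinates because the given norm need not be differentiable. -/
lemma exists_mem_domSubdiff_dist_lt [FiniteDimensional ℝ V] (hC : IsCompact C)
    (hh : ConvexOn ℝ C h) (hcont : ContinuousOn h C) {c : V} (hc : c ∈ C) {ε : ℝ} (hε : 0 < ε) :
    ∃ z ∈ domSubdiff C h, ‖z - c‖ < ε := by
  let e := toEuclidean (E := V)
  obtain ⟨B, hB⟩ := hC.exists_bound_of_continuousOn hcont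
  set L : ℝ := ‖(e.symm : EuclideanSpace ℝ (Fin (Module.finrank ℝ V)) →L[ℝ] V)‖ + 1 with hL
  have hL0 : 0 < L := by positivity
  have hB0 : 0 ≤ B := (norm_nonneg _).trans (hB c hc)
  -- Chosen so that a penalty below `2B + 1` means `L²‖e (z - c)‖² < ε²`.
  set k : ℝ := (2 * B + 1) * L ^ 2 / ε ^ 2 with hk
  have hk0 : 0 < k := by positivity
  obtain ⟨z, hz, hmin⟩ := hC.exists_isMinOn ⟨c, hc⟩
    (f := fun z => h z + k * ‖(e : V →L[ℝ] EuclideanSpace ℝ (Fin (Module.finrank ℝ V))) (z - c)‖ ^ 2) (by fun_prop)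
  refine ⟨z, mem_domSubdiff_of_isMinOn hh (e : V →L[ℝ] EuclideanSpace ℝ (Fin (Module.finrank ℝ V))) c k hz hmin, ?_⟩
  have h1 : h z + k * ‖e (z - c)‖ ^ 2 ≤ h c + k * ‖e (c - c)‖ ^ 2 := hmin hc
  have h2 := abs_le.1 (hB c hc)
  have h3 := abs_le.1 (hB z hz)
  simp only [sub_self, map_zero, norm_zero] at h1
  have h4 : ‖z - c‖ ≤ L * ‖e (z - c)‖ := by
    have := (e.symm : EuclideanSpace ℝ (Fin (Module.finrank ℝ V)) →L[ℝ] V).le_opNorm (e (z - c))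
    simp only [ContinuousLinearEquiv.coe_coe, ContinuousLinearEquiv.symm_apply_apply] at this
    exact this.trans (by gcongr; simp [hL])
  have h5 : k * ‖e (z - c)‖ ^ 2 < 2 * B + 1 := by nlinarith
  have h6 : L ^ 2 * ‖e (z - c)‖ ^ 2 < ε ^ 2 := by
    rw [hk, div_mul_eq_mul_div, div_lt_iff₀ (by positivity)] at h5
    have : (2 * B + 1) * (L ^ 2 * ‖e (z - c)‖ ^ 2) < (2 * B + 1) * ε ^ 2 := by nlinarith
    exact lt_of_mul_lt_mul_left this (by positivity)
  refine h4.trans_lt (lt_of_pow_lt_pow_left₀ 2 hε.le ?_)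
  rwa [mul_pow]

lemma IsDGF.convexOn (H : IsDGF C K h dh) : ConvexOn ℝ C h :=
  UniformConvexOn.convexOn H.strongConvexOn fun r => by have := H.modulus_pos; simp; positivity

/-- A continuous selection of the subdifferential is extremal along feasible directions. -/
lemma IsDGF.le_selection [FiniteDimensional ℝ V] (H : IsDGF C K h dh) (hC : IsCompact C)
    {x p : V} (hx : x ∈ domSubdiff C h) (hp : p ∈ C) {w : StrongDual ℝ V} (hw : w ∈ subdiff C h x) :
    w (p - x) ≤ dh x (p - x) := by
  let t : ℕ → ℝ := fun n => 1 / ((n : ℝ) + 1)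
  have ht0 : ∀ n, 0 < t n := fun n => by positivity
  have ht1 : ∀ n, t n ≤ 1 := fun n => by
    rw [div_le_one (by positivity)]; linarith [Nat.cast_nonneg (α := ℝ) n]
  have htt : Tendsto t atTop (𝓝 0) := tendsto_one_div_add_atTop_nhds_zero_nat
  have hmem : ∀ n, x + t n • (p - x) ∈ C := fun n =>
    H.convexOn.1.add_smul_sub_mem hx.1 hp ⟨(ht0 n).le, ht1 n⟩
  -- An error `tₙ²` is negligible against the displacement `tₙ (p - x)`, so `z` approaches `x` in
  -- the direction `p - x`.
  choose z hzd hzn using fun n => exists_mem_domSubdiff_dist_lt hC H.convexOn H.continuousOn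
    (hmem n) (pow_pos (ht0 n) 2)
  have hdir : Tendsto (fun n => (t n)⁻¹ • (z n - x)) atTop (𝓝 (p - x)) := by
    rw [tendsto_iff_norm_sub_tendsto_zero]
    refine squeeze_zero (fun _ => norm_nonneg _) (fun n => ?_) htt
    have : (t n)⁻¹ • (z n - x) - (p - x) = (t n)⁻¹ • (z n - (x + t n • (p - x))) := by
      rw [smul_sub, smul_sub, smul_add, smul_smul, inv_mul_cancel₀ (ht0 n).ne']; module
    rw [this, norm_smul, norm_inv, Real.norm_of_nonneg (ht0 n).le, inv_mul_le_iff₀ (ht0 n)]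
    nlinarith [hzn n]
  have hzx : Tendsto z atTop (𝓝 x) := by
    have := (htt.smul hdir).const_add x
    simp only [smul_smul, mul_inv_cancel₀ (ht0 _).ne', one_smul, zero_smul, add_zero,
      add_sub_cancel] at this
    exact this
  have hdhz : Tendsto (fun n => dh (z n)) atTop (𝓝 (dh x)) :=
    (H.selection_continuousOn x hx).tendsto.comp
      (tendsto_nhdsWithin_iff.2 ⟨hzx, Eventually.of_forall hzd⟩)
  have hlim : Tendsto (fun n => (dh (z n) - w) ((t n)⁻¹ • (z n - x))) atTop
      (𝓝 ((dh x - w) (p - x))) :=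
    (isBoundedBilinearMap_apply.continuous.tendsto (dh x - w, p - x)).comp
      ((hdhz.sub_const w).prodMk_nhds hdir)
  -- Monotonicity of the subdifferential between `z n` and `x`, passed to the limit by continuity of
  -- `dh`.
  have h0 : 0 ≤ (dh x - w) (p - x) := by
    refine ge_of_tendsto' hlim fun n => ?_
    have h1 := H.selection_mem _ (hzd n) x hx.1
    have h2 := hw (z n) (hzd n).1
    rw [← neg_sub, map_neg] at h1
    rw [map_smul, sub_apply, smul_eq_mul]
    exact mul_nonneg (inv_nonneg.2 (ht0 n).le) (by linarith)
  simpa using h0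

/-- Combine strong convexity on the segment from `x` to `p` with the subgradient inequality at `x`,
divide by `t`, and let `t → 0`. -/
lemma IsDGF.sq_norm_le_bregman (H : IsDGF C K h dh) {x p : V} (hx : x ∈ domSubdiff C h)
    (hp : p ∈ C) : K / 2 * ‖p - x‖ ^ 2 ≤ bregman h dh p x := by
  refine le_of_forall_le_add_mul (c := K / 2 * ‖p - x‖ ^ 2) fun t ht ht1 => ?_
  have h1 := H.strongConvexOn.2 hx.1 hp (sub_nonneg.2 ht1) ht.le (by ring)
  have hmem := H.convexOn.1 hx.1 hp (sub_nonneg.2 ht1) ht.le (by ring)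
  have h2 := H.selection_mem x hx _ hmem
  have h3 : (1 - t) • x + t • p - x = t • (p - x) := by module
  rw [h3, map_smul] at h2
  rw [norm_sub_rev] at h1
  simp only [smul_eq_mul] at h1 h2
  rw [bregman]
  have : t * (K / 2 * ‖p - x‖ ^ 2) ≤
      t * (h p - h x - dh x (p - x) + t * (K / 2 * ‖p - x‖ ^ 2)) := by nlinarith
  exact le_of_mul_le_mul_left this ht

lemma IsDGF.bregman_nonneg (H : IsDGF C K h dh) {x p : V} (hx : x ∈ domSubdiff C h)
    (hp : p ∈ C) : 0 ≤ bregman h dh p x :=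
  le_trans (by have := H.modulus_pos; positivity) (H.sq_norm_le_bregman hx hp)

lemma IsProx.mem_subdiff {x x' : V} {y : StrongDual ℝ V} (hx' : IsProx C h dh x y x') :
    dh x + y ∈ subdiff C h x' := fun z hz => by
  have h1 : y (x - x') + bregman h dh x' x ≤ y (x - z) + bregman h dh z x := hx'.2 hz
  simp only [bregman, map_sub, add_apply] at h1 ⊢
  linarith

lemma IsProx.mem_domSubdiff {x x' : V} {y : StrongDual ℝ V} (hx' : IsProx C h dh x y x') :
    x' ∈ domSubdiff C h := ⟨hx'.1, _, hx'.mem_subdiff⟩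

/-- The three-point inequality of the prox-mapping. -/
lemma IsProx.bregman_add_le [FiniteDimensional ℝ V] (H : IsDGF C K h dh) (hC : IsCompact C)
    {x x' p : V} {y : StrongDual ℝ V} (hx' : IsProx C h dh x y x') (hp : p ∈ C) :
    bregman h dh p x' + bregman h dh x' x ≤ bregman h dh p x + y (x' - p) := by
  have h1 := H.le_selection hC hx'.mem_domSubdiff hp hx'.mem_subdiff
  simp only [bregman, map_sub, add_apply] at h1 ⊢
  linarith

/-- Take `p = x` in the three-point inequality: both divergences on the left are at least `K/2 ‖x' -
x‖²`. -/
lemma IsProx.norm_sub_le [FiniteDimensional ℝ V] (H : IsDGF C K h dh) (hC : IsCompact C)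
    {x x' : V} {y : StrongDual ℝ V} (hx : x ∈ domSubdiff C h) (hx' : IsProx C h dh x y x') :
    ‖x' - x‖ ≤ ‖y‖ / K := by
  have h1 := hx'.bregman_add_le H hC hx.1
  have h2 := H.sq_norm_le_bregman hx hx'.1
  have h3 := H.sq_norm_le_bregman hx'.mem_domSubdiff hx.1
  have h4 : bregman h dh x x = 0 := by simp [bregman]
  have h5 := (le_abs_self _).trans (y.le_opNorm (x' - x))
  rw [norm_sub_rev] at h3
  rw [le_div_iff₀ H.modulus_pos]
  rcases (norm_nonneg (x' - x)).eq_or_lt with h0 | h0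
  · rw [← h0]; simp
  · have : ‖x' - x‖ * (‖x' - x‖ * K) ≤ ‖x' - x‖ * ‖y‖ := by nlinarith
    exact le_of_mul_le_mul_left this h0

/-- One step of optimistic mirror descent decreases the Bregman divergence up to second order. -/
lemma bregman_step_le [FiniteDimensional ℝ V] (H : IsDGF C K h dh) (hC : IsCompact C)
    {x x' y p : V} {u v : StrongDual ℝ V} {γ : ℝ} (hγ : 0 < γ) (hx : x ∈ domSubdiff C h)
    (hy : IsProx C h dh x (-(γ • u)) y) (hx' : IsProx C h dh x (-(γ • v)) x') (hp : p ∈ C) :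
    bregman h dh p x' + γ * v (y - p) ≤
      bregman h dh p x + 2 / K * γ ^ 2 * (‖u‖ ^ 2 + ‖v‖ ^ 2) := by
  have h1 := hx'.bregman_add_le H hC hp
  have h2 := H.bregman_nonneg hx hx'.1
  have h3 := hx'.norm_sub_le H hC hx
  have h4 := hy.norm_sub_le H hC hx
  have hK := H.modulus_pos
  rw [norm_neg, norm_smul, Real.norm_of_nonneg hγ.le] at h3 h4
  have h5 : ‖y - x'‖ ≤ γ * (‖u‖ + ‖v‖) / K := by
    calc ‖y - x'‖ = ‖(y - x) - (x' - x)‖ := by rw [sub_sub_sub_cancel_right]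
      _ ≤ _ := norm_sub_le _ _
      _ ≤ γ * ‖u‖ / K + γ * ‖v‖ / K := add_le_add h4 h3
      _ = _ := by ring
  have h6 : v (y - x') ≤ ‖v‖ * (γ * (‖u‖ + ‖v‖) / K) :=
    ((le_abs_self _).trans (v.le_opNorm _)).trans (by gcongr)
  have h7 : γ * v (y - x') ≤ 2 / K * γ ^ 2 * (‖u‖ ^ 2 + ‖v‖ ^ 2) := by
    calc γ * v (y - x') ≤ γ * (‖v‖ * (γ * (‖u‖ + ‖v‖) / K)) := by gcongr
      _ = γ ^ 2 / K * (‖v‖ * (‖u‖ + ‖v‖)) := by ring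
      _ ≤ γ ^ 2 / K * (2 * (‖u‖ ^ 2 + ‖v‖ ^ 2)) := by
        refine mul_le_mul_of_nonneg_left ?_ (by positivity)
        nlinarith [sq_nonneg (‖u‖ - ‖v‖), sq_nonneg ‖u‖, sq_nonneg ‖v‖]
      _ = _ := by ring
  -- The prox inequality controls `v (x' - p)`; the remainder is second order, since `y` and `x'`
  -- both lie within `O(γ)` of `x`.
  have h8 : v (y - p) = v (y - x') + v (x' - p) := by rw [← map_add, sub_add_sub_cancel]
  simp only [neg_apply, smul_apply, smul_eq_mul] at h1
  rw [h8, mul_add]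
  linarith

end Deterministic

/-! ### Almost supermartingales. -/

section Probability

variable {Ω : Type*} {m0 : MeasurableSpace Ω} {P : Measure Ω}

lemma ae_summable_of_summable_integral {a : ℕ → Ω → ℝ} (hai : ∀ n, Integrable (a n) P)
    (ha0 : ∀ n ω, 0 ≤ a n ω) (hs : Summable fun n => ∫ ω, a n ω ∂P) :
    ∀ᵐ ω ∂P, Summable fun n => a n ω := by
  have hm : ∀ n, AEMeasurable (fun ω => ENNReal.ofReal (a n ω)) P := fun n =>
    (hai n).aestronglyMeasurable.aemeasurable.ennreal_ofReal
  have h1 : ∫⁻ ω, ∑' n, ENNReal.ofReal (a n ω) ∂P ≠ ⊤ := by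
    rw [lintegral_tsum hm]
    simp_rw [← ofReal_integral_eq_lintegral_ofReal (hai _) (ae_of_all _ (ha0 _))]
    exact hs.tsum_ofReal_ne_top
  filter_upwards [ae_lt_top' (AEMeasurable.tsum hm) h1] with ω hω
  have := ENNReal.summable_toReal hω.ne
  simpa only [ENNReal.toReal_ofReal (ha0 _ ω)] using this

/-- A Robbins–Siegmund type convergence theorem for nonnegative almost supermartingales. -/
lemma ae_tendsto_and_summable_of_setIntegral_le [IsProbabilityMeasure P] (F : Filtration ℕ m0)
    {Z a : ℕ → Ω → ℝ} {c : ℕ → ℝ} (hZ : StronglyAdapted F Z) (hZi : ∀ n, Integrable (Z n) P)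
    (hZ0 : ∀ n ω, 0 ≤ Z n ω) (hai : ∀ n, Integrable (a n) P) (ha0 : ∀ n ω, 0 ≤ a n ω)
    (hc0 : ∀ n, 0 ≤ c n) (hc : Summable c)
    (H : ∀ n s, MeasurableSet[F n] s →
      ∫ ω in s, Z (n + 1) ω ∂P + ∫ ω in s, a n ω ∂P ≤ ∫ ω in s, Z n ω ∂P + c n * P.real s) :
    ∀ᵐ ω ∂P, (∃ l, Tendsto (fun n => Z n ω) atTop (𝓝 l)) ∧ Summable fun n => a n ω := by
  have hint : ∀ n, ∫ ω, Z n ω ∂P + ∑ k ∈ Finset.range n, ∫ ω, a k ω ∂P ≤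
      ∫ ω, Z 0 ω ∂P + ∑ k ∈ Finset.range n, c k := by
    intro n
    induction n with
    | zero => simp
    | succ n ih =>
      have := H n univ MeasurableSet.univ
      simp only [setIntegral_univ, probReal_univ, mul_one] at this
      rw [Finset.sum_range_succ, Finset.sum_range_succ]
      linarith
  have hcle : ∀ n, ∑ k ∈ Finset.range n, c k ≤ ∑' k, c k := fun n =>
    hc.sum_le_tsum _ fun k _ => hc0 k
  have hc0' : ∀ n, 0 ≤ ∑ k ∈ Finset.range n, c k := fun n => Finset.sum_nonneg fun k _ => hc0 k
  have hZint0 : ∀ n, 0 ≤ ∫ ω, Z n ω ∂P := fun n => integral_nonneg (hZ0 n)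
  have haint0 : ∀ n, 0 ≤ ∫ ω, a n ω ∂P := fun n => integral_nonneg (ha0 n)
  -- Compensating by the accumulated errors and changing sign gives a submartingale, to which Doob's
  -- convergence theorem applies.
  have hsub : Submartingale (fun n ω => ∑ k ∈ Finset.range n, c k - Z n ω) F P := by
    refine submartingale_of_setIntegral_le_succ
      (fun n => stronglyMeasurable_const.sub (hZ n))
      (fun n => (integrable_const _).sub (hZi n)) fun n s hs => ?_
    have h1 := H n s hs
    have h2 : 0 ≤ ∫ ω in s, a n ω ∂P := integral_nonneg (ha0 n)
    rw [integral_sub (integrable_const _) (hZi n).integrableOn,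
      integral_sub (integrable_const _) (hZi (n + 1)).integrableOn]
    simp only [integral_const, measureReal_restrict_apply_univ, smul_eq_mul,
      Finset.sum_range_succ]
    linarith
  -- One `∑ c` bounds the compensator, the other comes from the bound on `∫ Z n`.
  have hbdd : ∀ n, eLpNorm (fun ω => ∑ k ∈ Finset.range n, c k - Z n ω) 1 P ≤
      (Real.toNNReal (∫ ω, Z 0 ω ∂P + 2 * ∑' k, c k) : NNReal) := by
    intro n
    rw [eLpNorm_one_eq_lintegral_enorm, ← ofReal_integral_norm_eq_lintegral_enorm
      (hsub.integrable n)]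
    refine ENNReal.ofReal_le_ofReal ?_
    have h1 : ∫ ω, ‖∑ k ∈ Finset.range n, c k - Z n ω‖ ∂P ≤
        ∫ ω, (∑ k ∈ Finset.range n, c k + Z n ω) ∂P := by
      refine integral_mono ((integrable_const _).sub (hZi n)).norm
        ((integrable_const _).add (hZi n)) fun ω => ?_
      refine (norm_sub_le _ _).trans_eq ?_
      rw [Real.norm_of_nonneg (hc0' n), Real.norm_of_nonneg (hZ0 n ω)]
    rw [integral_add (integrable_const _) (hZi n)] at h1
    simp only [integral_const, probReal_univ, one_smul] at h1
    have h2 : 0 ≤ ∑ k ∈ Finset.range n, ∫ ω, a k ω ∂P := Finset.sum_nonneg fun k _ => haint0 k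
    linarith [hint n, hcle n]
  have hsum : Summable fun n => ∫ ω, a n ω ∂P :=
    summable_of_sum_range_le (c := ∫ ω, Z 0 ω ∂P + ∑' k, c k) haint0 fun n => by
      linarith [hint n, hcle n, hZint0 n]
  filter_upwards [hsub.exists_ae_tendsto_of_bdd hbdd,
    ae_summable_of_summable_integral hai ha0 hsum] with ω ⟨l, hl⟩ hω
  refine ⟨⟨∑' k, c k - l, ?_⟩, hω⟩
  simpa using hc.hasSum.tendsto_sum_nat.sub hl

end Probability

/-! ### Histories and measurability. -/

section Measurability

lemma comap_borel_le_of_stronglyMeasurable {Ω V : Type*} [NormedAddCommGroup V]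
    {m : MeasurableSpace Ω} {Z : Ω → V}
    (hZ : StronglyMeasurable[m] Z) : MeasurableSpace.comap Z (borel V) ≤ m := by
  borelize V
  exact hZ.measurable.comap_le

lemma history_le {Ω V : Type*} [NormedAddCommGroup V]
    {m0 : MeasurableSpace Ω} {X : ℕ → Ω → V} (hX : ∀ n, StronglyMeasurable (X n))
    (n : ℕ) : history X n ≤ m0 :=
  iSup₂_le fun i _ => comap_borel_le_of_stronglyMeasurable (hX i)

lemma halfHistory_le {Ω V : Type*} [NormedAddCommGroup V]
    {m0 : MeasurableSpace Ω} {X Y : ℕ → Ω → V}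
    (hX : ∀ n, StronglyMeasurable (X n)) (hY : ∀ n, StronglyMeasurable (Y n)) (n : ℕ) :
    halfHistory X Y n ≤ m0 :=
  sup_le (history_le hX n) (comap_borel_le_of_stronglyMeasurable (hY n))

variable {Ω V : Type*} [NormedAddCommGroup V] [NormedSpace ℝ V] [FiniteDimensional ℝ V]

lemma stronglyMeasurable_of_comap_borel_le {m : MeasurableSpace Ω} {Z : Ω → V}
    (hZ : MeasurableSpace.comap Z (borel V) ≤ m) : StronglyMeasurable[m] Z := by
  borelize V
  have := FiniteDimensional.proper ℝ V
  exact (Measurable.of_comap_le hZ).stronglyMeasurable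

/-- Factor through the subtype `D`: divergences are continuous only on the domain of the
subdifferential. -/
lemma stronglyMeasurable_comp_of_continuousOn {m : MeasurableSpace Ω} {Z : Ω → V}
    {D : Set V} {φ : V → ℝ} (hφ : ContinuousOn φ D) (hZ : StronglyMeasurable[m] Z)
    (hD : ∀ ω, Z ω ∈ D) : StronglyMeasurable[m] fun ω => φ (Z ω) := by
  borelize V
  have := FiniteDimensional.proper ℝ V
  have h1 : Measurable[m] fun ω => (⟨Z ω, hD ω⟩ : D) := hZ.measurable.subtype_mk
  exact (continuousOn_iff_continuous_domRestrict.1 hφ).comp_stronglyMeasurable h1.stronglyMeasurable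

lemma stronglyMeasurable_history (X : ℕ → Ω → V) {i n : ℕ} (hi : i ≤ n) :
    StronglyMeasurable[history X n] (X i) :=
  stronglyMeasurable_of_comap_borel_le
    (le_iSup₂ (f := fun i (_ : i ≤ n) => MeasurableSpace.comap (X i) (borel V)) i hi)

lemma stronglyMeasurable_halfHistory (X Y : ℕ → Ω → V) (n : ℕ) :
    StronglyMeasurable[halfHistory X Y n] (Y n) :=
  stronglyMeasurable_of_comap_borel_le le_sup_right

/-- The filtration generated by the states. -/
def historyFiltration {m0 : MeasurableSpace Ω} {X : ℕ → Ω → V}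
    (hX : ∀ n, StronglyMeasurable (X n)) : Filtration ℕ m0 where
  seq := history X
  mono' _ _ hij := iSup₂_le fun k hk =>
    le_iSup₂ (f := fun i (_ : i ≤ _) => MeasurableSpace.comap (X i) (borel V)) k (hk.trans hij)
  le' := history_le hX

end Measurability

/-! ### Conditional expectations of oracle signals. -/

section Oracle

variable {Ω V : Type*} [NormedAddCommGroup V] [NormedSpace ℝ V]
  {m m0 : MeasurableSpace Ω} {P : Measure Ω}
  {g : V → StrongDual ℝ V} {G : ℝ} {Z : Ω → V} {u : Ω → StrongDual ℝ V}

lemma IsOracleSignal.integrable_sq (hu : IsOracleSignal P m g G Z u) :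
    Integrable (fun ω => ‖u ω‖ ^ 2) P := hu.memLp.integrable_norm_pow two_ne_zero

variable [IsProbabilityMeasure P]

lemma IsOracleSignal.setIntegral_sq_le (hu : IsOracleSignal P m g G Z u) (hm : m ≤ m0)
    {s : Set Ω} (hs : MeasurableSet[m] s) : ∫ ω in s, ‖u ω‖ ^ 2 ∂P ≤ G ^ 2 * P.real s := by
  rw [← setIntegral_condExp hm hu.integrable_sq hs]
  refine (setIntegral_mono_ae integrable_condExp.integrableOn (integrable_const _).integrableOn
    hu.meanSquare).trans_eq ?_
  rw [setIntegral_const, smul_eq_mul, mul_comm]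

lemma IsOracleSignal.integrable_apply (hu : IsOracleSignal P m g G Z u) {q : Ω → V}
    (hq : AEStronglyMeasurable q P) {M : ℝ} (hM : ∀ ω, ‖q ω‖ ≤ M) :
    Integrable (fun ω => u ω (q ω)) P := by
  refine ((hu.memLp.integrable one_le_two).norm.mul_const M).mono' ?_ (ae_of_all _ fun ω => ?_)
  · exact isBoundedBilinearMap_apply.continuous.comp_aestronglyMeasurable
      (hu.memLp.aestronglyMeasurable.prodMk hq)
  · exact ((u ω).le_opNorm _).trans (by gcongr; exact hM ω)

/-- A bounded `m`-measurable direction can be pulled out of the conditional expectation of the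
pairing. -/
lemma IsOracleSignal.condExp_apply (hu : IsOracleSignal P m g G Z u) (hm : m ≤ m0)
    {q : Ω → V} (hq : StronglyMeasurable[m] q) {M : ℝ} (hM : ∀ ω, ‖q ω‖ ≤ M) :
    P[fun ω => u ω (q ω) | m] =ᵐ[P] fun ω => g (Z ω) (q ω) := by
  have h1 := condExp_bilin_of_stronglyMeasurable_right (μ := P)
    (ContinuousLinearMap.id ℝ (StrongDual ℝ V)) hq
    (hu.integrable_apply (hq.mono hm).aestronglyMeasurable hM) (hu.memLp.integrable one_le_two)
  filter_upwards [h1, hu.unbiased] with ω h1 h2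
  rw [← h2]
  exact h1

lemma IsOracleSignal.integrable_field_apply (hu : IsOracleSignal P m g G Z u) (hm : m ≤ m0)
    {q : Ω → V} (hq : StronglyMeasurable[m] q) {M : ℝ} (hM : ∀ ω, ‖q ω‖ ≤ M) :
    Integrable (fun ω => g (Z ω) (q ω)) P :=
  integrable_condExp.congr (hu.condExp_apply hm hq hM)

lemma IsOracleSignal.setIntegral_apply (hu : IsOracleSignal P m g G Z u) (hm : m ≤ m0)
    {q : Ω → V} (hq : StronglyMeasurable[m] q) {M : ℝ} (hM : ∀ ω, ‖q ω‖ ≤ M)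
    {s : Set Ω} (hs : MeasurableSet[m] s) :
    ∫ ω in s, u ω (q ω) ∂P = ∫ ω in s, g (Z ω) (q ω) ∂P := by
  rw [← setIntegral_condExp hm
    (hu.integrable_apply (hq.mono hm).aestronglyMeasurable hM) hs]
  exact setIntegral_congr_ae (hm s hs) ((hu.condExp_apply hm hq hM).mono fun ω h _ => h)

end Oracle

/-! ### Pathwise convergence. -/

section Convergence

variable {V : Type*} [NormedAddCommGroup V] [NormedSpace ℝ V]
  {C S : Set V} {h : V → ℝ} {dh : V → StrongDual ℝ V} {K : ℝ}

lemma bregman_sub_bregman (p q x : V) :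
    bregman h dh p x - bregman h dh q x = h p - h q - dh x (p - q) := by
  simp only [bregman, map_sub]; ring

lemma IsDGF.continuousOn_bregman (H : IsDGF C K h dh) (p : V) :
    ContinuousOn (bregman h dh p) (domSubdiff C h) := by
  have h1 : ContinuousOn h (domSubdiff C h) := H.continuousOn.mono fun x hx => hx.1
  have h2 : ContinuousOn (fun x => dh x (p - x)) (domSubdiff C h) :=
    isBoundedBilinearMap_apply.continuous.comp_continuousOn
      (H.selection_continuousOn.prodMk (by fun_prop))
  exact (continuousOn_const.sub h1).sub h2

/-- Since `p ↦ bregman h dh p x - h p` is affine, convergence of Bregman divergences on a set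
can be tested on finitely many points. -/
lemma exists_finite_forall_tendsto_bregman [FiniteDimensional ℝ V] (h : V → ℝ)
    (dh : V → StrongDual ℝ V) (hS : S.Nonempty) :
    ∃ T ⊆ S, T.Finite ∧ ∀ x : ℕ → V,
      (∀ p ∈ T, ∃ l, Tendsto (fun n => bregman h dh p (x n)) atTop (𝓝 l)) →
      ∀ p ∈ S, ∃ l, Tendsto (fun n => bregman h dh p (x n)) atTop (𝓝 l) := by
  obtain ⟨q, hq⟩ := hS
  obtain ⟨b, hbS, hspan, hb⟩ := exists_linearIndependent ℝ ((fun p => p - q) '' S)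
  refine ⟨insert q ((fun w => w + q) '' b), ?_, (hb.setFinite.image _).insert _, ?_⟩
  · refine insert_subset hq ?_
    rintro _ ⟨w, hw, rfl⟩
    obtain ⟨p, hp, rfl⟩ := hbS hw
    simpa using hp
  · intro x hx p hp
    -- The directions in which `dh (x n)` converges form a subspace; containing `b`, it contains
    -- every `p - q` with `p ∈ S`.
    let L : Submodule ℝ V :=
      { carrier := {w | ∃ l, Tendsto (fun n => dh (x n) w) atTop (𝓝 l)}
        add_mem' := by
          rintro a b ⟨l, hl⟩ ⟨l', hl'⟩
          exact ⟨l + l', by simpa only [map_add] using hl.add hl'⟩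
        zero_mem' := ⟨0, by simp⟩
        smul_mem' := by
          rintro c a ⟨l, hl⟩
          exact ⟨c • l, by simpa only [map_smul] using hl.const_smul c⟩ }
    obtain ⟨l₀, hl₀⟩ := hx q (mem_insert _ _)
    have hbL : b ⊆ L := by
      intro w hw
      obtain ⟨l, hl⟩ := hx (w + q) (mem_insert_of_mem _ ⟨w, hw, rfl⟩)
      refine ⟨h (w + q) - h q - (l - l₀), ?_⟩
      refine ((hl.sub hl₀).const_sub (h (w + q) - h q)).congr fun n => ?_
      rw [bregman_sub_bregman, add_sub_cancel_right, sub_sub_cancel]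
    have hpL : p - q ∈ L := by
      have : p - q ∈ Submodule.span ℝ b := hspan ▸ Submodule.subset_span ⟨p, hp, rfl⟩
      exact Submodule.span_le.2 hbL this
    obtain ⟨l, hl⟩ := hpL
    refine ⟨h p - h q - l + l₀, ((hl.const_sub (h p - h q)).add hl₀).congr fun n => ?_⟩
    rw [← bregman_sub_bregman, sub_add_cancel]

/-- If a weighted sum with nonsummable weights converges, the terms cluster at zero. -/
lemma exists_subseq_tendsto_zero {γ b : ℕ → ℝ} (hγ : ∀ n, 0 < γ n)
    (hγ_sum : Tendsto (fun N => ∑ n ∈ Finset.range N, γ n) atTop atTop) (hb : ∀ n, 0 ≤ b n)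
    (hs : Summable fun n => γ n * b n) :
    ∃ φ : ℕ → ℕ, StrictMono φ ∧ Tendsto (b ∘ φ) atTop (𝓝 0) := by
  -- Otherwise `b ≥ 1 / (k + 1)` eventually, and `γ` would be summable by comparison.
  have hfreq : ∀ k : ℕ, ∃ᶠ n in atTop, b n < 1 / ((k : ℝ) + 1) := by
    intro k hk
    obtain ⟨N, hN⟩ := eventually_atTop.1 hk
    have hk0 : (0 : ℝ) < k + 1 := by positivity
    have h1 : Summable fun n => γ (n + N) := by
      refine Summable.of_nonneg_of_le (fun n => (hγ _).le) (fun n => ?_)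
        (((summable_nat_add_iff N).2 hs).mul_left ((k : ℝ) + 1))
      have h2 := not_lt.1 (hN (n + N) (Nat.le_add_left _ _))
      rw [div_le_iff₀ hk0] at h2
      nlinarith [hγ (n + N)]
    exact not_tendsto_nhds_of_tendsto_atTop hγ_sum _
      ((summable_nat_add_iff N).1 h1).hasSum.tendsto_sum_nat
  obtain ⟨φ, hφ, hφb⟩ := extraction_forall_of_frequently hfreq
  exact ⟨φ, hφ, squeeze_zero (fun n => hb _) (fun n => (hφb n).le)
    tendsto_one_div_add_atTop_nhds_zero_nat⟩

lemma tendsto_of_bregman_tendsto_of_summable (H : IsDGF C K h dh) (hC : IsCompact C)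
    (hrec : BregmanReciprocity C h dh) {g : V → StrongDual ℝ V} (hg : ContinuousOn g C)
    {γ : ℕ → ℝ} (hγ : ∀ n, 0 < γ n)
    (hγ_sum : Tendsto (fun N => ∑ n ∈ Finset.range N, γ n) atTop atTop)
    {q : V} (hmono : ∀ x ∈ C, 0 ≤ g x (x - q)) (hstrict : ∀ x ∈ C, x ∉ S → 0 < g x (x - q))
    {x y : ℕ → V} (hx : ∀ n, x n ∈ domSubdiff C h) (hy : ∀ n, y n ∈ C)
    (hxy : Tendsto (fun n => x n - y n) atTop (𝓝 0))
    (hs : Summable fun n => γ n * g (y n) (y n - q))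
    (hD : ∀ p ∈ S, ∃ l, Tendsto (fun n => bregman h dh p (x n)) atTop (𝓝 l)) :
    ∃ p ∈ S, Tendsto x atTop (𝓝 p) := by
  obtain ⟨φ, hφ, hb⟩ := exists_subseq_tendsto_zero hγ hγ_sum (fun n => hmono _ (hy n)) hs
  obtain ⟨p, hp, ψ, hψ, hyp⟩ := hC.tendsto_subseq fun n => hy (φ n)
  have hgc : ContinuousOn (fun z => g z (z - q)) C :=
    isBoundedBilinearMap_apply.continuous.comp_continuousOn (hg.prodMk (by fun_prop))
  have h1 : Tendsto (fun n => g (y (φ (ψ n))) (y (φ (ψ n)) - q)) atTop (𝓝 (g p (p - q))) :=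
    (hgc p hp).tendsto.comp
      (tendsto_nhdsWithin_iff.2 ⟨hyp, Eventually.of_forall fun n => hy _⟩)
  have h2 : g p (p - q) = 0 := tendsto_nhds_unique h1 (hb.comp hψ.tendsto_atTop)
  have hpS : p ∈ S := by
    by_contra hpS
    exact (hstrict p hp hpS).ne' h2
  have hmono' := (hφ.comp hψ).tendsto_atTop
  have hxp : Tendsto (fun n => x (φ (ψ n))) atTop (𝓝 p) := by
    simpa using (hxy.comp hmono').add hyp
  obtain ⟨l, hl⟩ := hD p hpS
  -- The full sequence of divergences converges, so its limit is read off along the subsequence,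
  -- where reciprocity applies.
  have hl0 : l = 0 := tendsto_nhds_unique (hl.comp hmono')
    (hrec p hp _ (fun n => hx (φ (ψ n))) hxp)
  rw [hl0] at hl
  refine ⟨p, hpS, ?_⟩
  have hK := H.modulus_pos
  have hsq : Tendsto (fun n => ‖p - x n‖ ^ 2) atTop (𝓝 0) := by
    refine squeeze_zero (fun n => by positivity) (fun n => ?_)
      (by simpa using hl.const_mul (2 / K))
    rw [div_mul_eq_mul_div, le_div_iff₀ hK]
    linarith [H.sq_norm_le_bregman (hx n) hp]
  rw [tendsto_iff_norm_sub_tendsto_zero]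
  have := hsq.sqrt
  simpa [Real.sqrt_sq, norm_sub_rev] using this

end Convergence

/-! ### Almost sure behaviour of the algorithm. -/

section Dynamics

variable {Ω V : Type*} [NormedAddCommGroup V] [NormedSpace ℝ V]
  {C S : Set V} {h : V → ℝ} {dh : V → StrongDual ℝ V} {K G : ℝ} {γ : ℕ → ℝ}
  {g : V → StrongDual ℝ V} {m0 : MeasurableSpace Ω} {P : Measure Ω} [IsProbabilityMeasure P]
  {X Y : ℕ → Ω → V} {u v : ℕ → Ω → StrongDual ℝ V}

lemma IsOMD.mem_domSubdiff (A : IsOMD C h dh γ X Y u v) (n : ℕ) (ω : Ω) :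
    X n ω ∈ domSubdiff C h := by
  cases n with
  | zero => exact A.init ω
  | succ n => exact (A.step n ω).mem_domSubdiff

variable [FiniteDimensional ℝ V]

/-- The distance between the leading and the base state vanishes almost surely. -/
lemma IsOMD.ae_tendsto_sub (A : IsOMD C h dh γ X Y u v) (H : IsDGF C K h dh) (hC : IsCompact C)
    (hγ : ∀ n, 0 < γ n) (hγ_sq : Summable fun n => γ n ^ 2)
    (hX : ∀ n, StronglyMeasurable (X n))
    (hu : ∀ n, IsOracleSignal P (history X n) g G (X n) (u n)) :
    ∀ᵐ ω ∂P, Tendsto (fun n => X n ω - Y n ω) atTop (𝓝 0) := by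
  -- The prox step has length at most `γₙ‖uₙ‖ / K`, so summability of the expected squares is
  -- enough.
  have hsum : Summable fun n => ∫ ω, γ n ^ 2 * ‖u n ω‖ ^ 2 ∂P := by
    refine Summable.of_nonneg_of_le (fun n => integral_nonneg fun ω => by positivity) (fun n => ?_)
      (hγ_sq.mul_right (G ^ 2))
    have := (hu n).setIntegral_sq_le (history_le hX n) MeasurableSet.univ
    rw [setIntegral_univ, probReal_univ, mul_one] at this
    rw [integral_const_mul]
    gcongr
  filter_upwards [ae_summable_of_summable_integral (fun n => (hu n).integrable_sq.const_mul _)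
    (fun n ω => by positivity) hsum] with ω hω
  have h1 := hω.tendsto_atTop_zero.sqrt
  rw [Real.sqrt_zero] at h1
  rw [tendsto_zero_iff_norm_tendsto_zero]
  have h3 := h1.div_const K
  rw [zero_div] at h3
  refine squeeze_zero (fun n => norm_nonneg _) (fun n => ?_) h3
  have h2 := (A.half_step n ω).norm_sub_le H hC (A.mem_domSubdiff n ω)
  rw [norm_neg, norm_smul, Real.norm_of_nonneg (hγ n).le] at h2
  rwa [← mul_pow, Real.sqrt_sq (mul_nonneg (hγ n).le (norm_nonneg _)), norm_sub_rev]

/-- Almost sure convergence of the Bregman divergence relative to a solution of the variational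
inequality. -/
lemma IsOMD.ae_tendsto_bregman_and_summable (A : IsOMD C h dh γ X Y u v) (H : IsDGF C K h dh)
    (hC : IsCompact C) (hγ : ∀ n, 0 < γ n) (hγ_sq : Summable fun n => γ n ^ 2)
    (hX : ∀ n, StronglyMeasurable (X n)) (hY : ∀ n, StronglyMeasurable (Y n))
    (hu : ∀ n, IsOracleSignal P (history X n) g G (X n) (u n))
    (hv : ∀ n, IsOracleSignal P (halfHistory X Y n) g G (Y n) (v n))
    {p : V} (hp : p ∈ C) (hmono : ∀ x ∈ C, 0 ≤ g x (x - p)) :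
    ∀ᵐ ω ∂P, (∃ l, Tendsto (fun n => bregman h dh p (X n ω)) atTop (𝓝 l)) ∧
      Summable fun n => γ n * g (Y n ω) (Y n ω - p) := by
  have hK := H.modulus_pos
  have hYC : ∀ n ω, Y n ω ∈ C := fun n ω => (A.half_step n ω).1
  have hD0 : ∀ n ω, 0 ≤ bregman h dh p (X n ω) := fun n ω =>
    H.bregman_nonneg (A.mem_domSubdiff n ω) hp
  have hDm : ∀ {i n}, i ≤ n → StronglyMeasurable[history X n] fun ω => bregman h dh p (X i ω) :=
    fun hi => stronglyMeasurable_comp_of_continuousOn (H.continuousOn_bregman p)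
      (stronglyMeasurable_history X hi) (A.mem_domSubdiff _)
  -- the initial divergence need not be integrable, so the process is normalized
  let W : Ω → ℝ := fun ω => (1 + bregman h dh p (X 0 ω))⁻¹
  have hW0 : ∀ ω, 0 < W ω := fun ω => by have := hD0 0 ω; positivity
  have hW1 : ∀ ω, W ω ≤ 1 := fun ω => inv_le_one_of_one_le₀ (by linarith [hD0 0 ω])
  have hWm : ∀ n, StronglyMeasurable[history X n] W := fun n =>
    (((hDm (Nat.zero_le n)).measurable.const_add 1).inv).stronglyMeasurable
  obtain ⟨M, hM⟩ : ∃ M, ∀ x ∈ C, ‖x - p‖ ≤ M :=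
    hC.exists_bound_of_continuousOn (f := fun x => x - p) (by fun_prop)
  -- Placing the weight inside the direction keeps it bounded and half-history measurable, as the
  -- oracle lemmas require.
  let q : ℕ → Ω → V := fun n ω => W ω • (Y n ω - p)
  have hqm : ∀ n, StronglyMeasurable[halfHistory X Y n] (q n) := fun n => by
    have h1 : StronglyMeasurable[halfHistory X Y n] W := (hWm n).mono le_sup_left
    have h2 := (stronglyMeasurable_halfHistory X Y n).sub
      (stronglyMeasurable_const (b := p))
    exact h1.smul h2
  have hqM : ∀ n ω, ‖q n ω‖ ≤ M := fun n ω => by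
    rw [norm_smul, Real.norm_of_nonneg (hW0 ω).le]
    exact (mul_le_of_le_one_left (norm_nonneg _) (hW1 ω)).trans (hM _ (hYC n ω))
  have hm := halfHistory_le hX hY
  let Z : ℕ → Ω → ℝ := fun n ω => W ω * bregman h dh p (X n ω)
  let a : ℕ → Ω → ℝ := fun n ω => γ n * g (Y n ω) (q n ω)
  let e : ℕ → Ω → ℝ := fun n ω => 2 / K * γ n ^ 2 * (‖u n ω‖ ^ 2 + ‖v n ω‖ ^ 2)
  have hstep : ∀ n ω, Z (n + 1) ω + γ n * v n ω (q n ω) ≤ Z n ω + e n ω := by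
    intro n ω
    have h1 := bregman_step_le H hC (hγ n) (A.mem_domSubdiff n ω) (A.half_step n ω) (A.step n ω) hp
    have h2 : 0 ≤ e n ω := by positivity
    have h3 : v n ω (q n ω) = W ω * v n ω (Y n ω - p) := by rw [map_smul, smul_eq_mul]
    have h4 := mul_le_mul_of_nonneg_left h1 (hW0 ω).le
    have h5 : W ω * e n ω ≤ e n ω := mul_le_of_le_one_left h2 (hW1 ω)
    simp only [Z]
    rw [h3]
    simp only [e] at h5 ⊢
    linarith
  have hZ0 : ∀ n ω, 0 ≤ Z n ω := fun n ω => mul_nonneg (hW0 ω).le (hD0 n ω)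
  have hZm : ∀ n, StronglyMeasurable[history X n] (Z n) := fun n => (hWm n).mul (hDm le_rfl)
  have hei : ∀ n, Integrable (e n) P := fun n =>
    ((hu n).integrable_sq.add (hv n).integrable_sq).const_mul _
  have hvi : ∀ n, Integrable (fun ω => v n ω (q n ω)) P := fun n =>
    (hv n).integrable_apply ((hqm n).mono (hm n)).aestronglyMeasurable (hqM n)
  -- Normalization gives `Z 0 ≤ 1`; the one-step inequality propagates integrability.
  have hZi : ∀ n, Integrable (Z n) P := by
    intro n
    induction n with
    | zero =>
      refine (integrable_const (1 : ℝ)).mono'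
        ((hZm 0).mono (history_le hX 0)).aestronglyMeasurable (ae_of_all _ fun ω => ?_)
      rw [Real.norm_of_nonneg (hZ0 0 ω)]
      simp only [Z, W]
      rw [inv_mul_le_iff₀ (by linarith [hD0 0 ω])]
      linarith
    | succ n ih =>
      refine ((ih.add (hei n)).sub ((hvi n).const_mul (γ n))).mono'
        ((hZm _).mono (history_le hX _)).aestronglyMeasurable (ae_of_all _ fun ω => ?_)
      rw [Real.norm_of_nonneg (hZ0 _ ω)]
      exact le_sub_iff_add_le.2 (hstep n ω)
  have ha : ∀ n ω, a n ω = W ω * (γ n * g (Y n ω) (Y n ω - p)) := fun n ω => by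
    simp only [a, q, map_smul, smul_eq_mul]; ring
  have ha0 : ∀ n ω, 0 ≤ a n ω := fun n ω => by
    rw [ha]
    exact mul_nonneg (hW0 ω).le (mul_nonneg (hγ n).le (hmono _ (hYC n ω)))
  have hai : ∀ n, Integrable (a n) P := fun n =>
    ((hv n).integrable_field_apply (hm n) (hqm n) (hqM n)).const_mul _
  have hset : ∀ n s, MeasurableSet[history X n] s →
      ∫ ω in s, Z (n + 1) ω ∂P + ∫ ω in s, a n ω ∂P ≤
        ∫ ω in s, Z n ω ∂P + (2 / K * γ n ^ 2 * (2 * G ^ 2)) * P.real s := by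
    intro n s hs
    -- Events known at stage `n` are known at the half-stage, so the properties of `v n` may be used
    -- on `s`.
    have hs' : MeasurableSet[halfHistory X Y n] s := (le_sup_left : history X n ≤ _) s hs
    have h1 : ∫ ω in s, (Z (n + 1) ω + γ n * v n ω (q n ω)) ∂P ≤ ∫ ω in s, (Z n ω + e n ω) ∂P :=
      integral_mono ((hZi _).add ((hvi n).const_mul _)).integrableOn
        ((hZi n).add (hei n)).integrableOn (hstep n)
    rw [integral_add (hZi _).integrableOn ((hvi n).const_mul _).integrableOn,
      integral_add (hZi n).integrableOn (hei n).integrableOn, integral_const_mul,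
      (hv n).setIntegral_apply (hm n) (hqm n) (hqM n) hs', ← integral_const_mul] at h1
    have h2 : ∫ ω in s, e n ω ∂P ≤ (2 / K * γ n ^ 2 * (2 * G ^ 2)) * P.real s := by
      have h3 := (hu n).setIntegral_sq_le (history_le hX n) hs
      have h4 := (hv n).setIntegral_sq_le (hm n) hs'
      simp only [e]
      rw [integral_const_mul, integral_add (hu n).integrable_sq.integrableOn
        (hv n).integrable_sq.integrableOn, mul_assoc (2 / K * γ n ^ 2)]
      refine mul_le_mul_of_nonneg_left ?_ (by positivity)
      linarith
    exact h1.trans (by gcongr)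
  have hcs : Summable fun n => 2 / K * γ n ^ 2 * (2 * G ^ 2) :=
    (hγ_sq.mul_left (2 / K)).mul_right _
  filter_upwards [ae_tendsto_and_summable_of_setIntegral_le (historyFiltration hX) hZm hZi hZ0
    hai ha0 (fun n => by positivity) hcs hset] with ω ⟨⟨l, hl⟩, hs⟩
  -- The weight is positive and does not depend on `n`, so it cancels pathwise.
  refine ⟨⟨(W ω)⁻¹ * l, (hl.const_mul (W ω)⁻¹).congr fun n => ?_⟩, ?_⟩
  · exact inv_mul_cancel_left₀ (hW0 ω).ne' _
  · simp only [ha] at hs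
    exact (summable_mul_left_iff (hW0 ω).ne').1 hs

/-- Almost sure convergence of optimistic mirror descent for a continuous field `g` and a set `S`
of strict solutions of the associated variational inequality. -/
theorem IsOMD.ae_exists_tendsto (A : IsOMD C h dh γ X Y u v) (H : IsDGF C K h dh)
    (hC : IsCompact C) (hrec : BregmanReciprocity C h dh) (hg : ContinuousOn g C)
    (hγ : ∀ n, 0 < γ n) (hγ_sum : Tendsto (fun N => ∑ n ∈ Finset.range N, γ n) atTop atTop)
    (hγ_sq : Summable fun n => γ n ^ 2)
    (hX : ∀ n, StronglyMeasurable (X n)) (hY : ∀ n, StronglyMeasurable (Y n))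
    (hu : ∀ n, IsOracleSignal P (history X n) g G (X n) (u n))
    (hv : ∀ n, IsOracleSignal P (halfHistory X Y n) g G (Y n) (v n))
    (hS : S.Nonempty) (hSC : S ⊆ C) (hmono : ∀ p ∈ S, ∀ x ∈ C, 0 ≤ g x (x - p))
    (hstrict : ∀ p ∈ S, ∀ x ∈ C, x ∉ S → 0 < g x (x - p)) :
    ∀ᵐ ω ∂P, ∃ p ∈ S, Tendsto (fun n => X n ω) atTop (𝓝 p) := by
  obtain ⟨T, hTS, hT, hTD⟩ := exists_finite_forall_tendsto_bregman h dh hS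
  obtain ⟨q, hq⟩ := hS
  have key := fun p (hp : p ∈ S) =>
    A.ae_tendsto_bregman_and_summable H hC hγ hγ_sq hX hY hu hv (hSC hp) (hmono p hp)
  filter_upwards [(ae_ball_iff hT.countable).2 fun p hp => key p (hTS hp), key q hq,
    A.ae_tendsto_sub H hC hγ hγ_sq hX hu] with ω hω hωq hωs
  exact tendsto_of_bregman_tendsto_of_summable H hC hrec hg hγ hγ_sum (hmono q hq) (hstrict q hq)
    (fun n => A.mem_domSubdiff n ω) (fun n => (A.half_step n ω).1) hωs hωq.2
    (hTD _ fun p hp => (hω p hp).1)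

end Dynamics

/-! ### Compactness of the feasible set and continuity of the gradient field. -/

section Field

variable {V₁ V₂ : Type*} [NormedAddCommGroup V₁] [NormedSpace ℝ V₁]
  [NormedAddCommGroup V₂] [NormedSpace ℝ V₂] {C₁ : Set V₁} {C₂ : Set V₂} {f : V₁ → V₂ → ℝ}

lemma isCompact_feasible (hC₁ : IsCompact C₁) (hC₂ : IsCompact C₂) :
    IsCompact (feasible C₁ C₂) := by
  have : feasible C₁ C₂ =
      (WithLp.prodContinuousLinearEquiv 2 ℝ V₁ V₂).toHomeomorph ⁻¹' (C₁ ×ˢ C₂) := rfl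
  rw [this, Homeomorph.isCompact_preimage]
  exact hC₁.prod hC₂

/-- At feasible points the partial derivatives are restrictions of the total derivative, which is
continuous there because `f` is `C¹`. -/
lemma continuousOn_gradField
    (hf : ∀ x₁ ∈ C₁, ∀ x₂ ∈ C₂, ContDiffAt ℝ 1 (fun z : V₁ × V₂ => f z.1 z.2) (x₁, x₂)) :
    ContinuousOn (gradField f) (feasible C₁ C₂) := by
  let F : V₁ × V₂ → ℝ := fun z => f z.1 z.2
  let π : Space V₁ V₂ → V₁ × V₂ := fun x => (x.fst, x.snd)
  have hπ : Continuous π := (WithLp.prodContinuousLinearEquiv 2 ℝ V₁ V₂).continuous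
  have hF : ContinuousOn (fun x => fderiv ℝ F (π x)) (feasible C₁ C₂) := fun x hx => by
    have h1 : ContinuousAt (fderiv ℝ F) (π x) :=
      (hf _ hx.1 _ hx.2).continuousAt_fderiv one_ne_zero
    exact (h1.comp hπ.continuousAt).continuousWithinAt
  have heq : EqOn (gradField f)
      (fun x => ((fderiv ℝ F (π x)).comp (ContinuousLinearMap.inl ℝ V₁ V₂)).comp
          (WithLp.fstL 2 ℝ V₁ V₂) -
        ((fderiv ℝ F (π x)).comp (ContinuousLinearMap.inr ℝ V₁ V₂)).comp
          (WithLp.sndL 2 ℝ V₁ V₂)) (feasible C₁ C₂) := by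
    intro x hx
    have hd : HasFDerivAt F (fderiv ℝ F (π x)) (x.fst, x.snd) :=
      ((hf _ hx.1 _ hx.2).differentiableAt one_ne_zero).hasFDerivAt
    have h1 : HasFDerivAt (fun a => f a x.snd)
        ((fderiv ℝ F (π x)).comp (ContinuousLinearMap.inl ℝ V₁ V₂)) x.fst :=
      HasFDerivAt.comp (g := F) (f := fun e => (e, x.snd)) x.fst hd (hasFDerivAt_prodMk_left x.fst x.snd)
    have h2 : HasFDerivAt (fun b => f x.fst b)
        ((fderiv ℝ F (π x)).comp (ContinuousLinearMap.inr ℝ V₁ V₂)) x.snd :=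
      HasFDerivAt.comp (g := F) (f := fun e => (x.fst, e)) x.snd hd (hasFDerivAt_prodMk_right x.fst x.snd)
    simp only [gradField]
    rw [h1.fderiv, h2.fderiv]
  refine ContinuousOn.congr ?_ heq
  exact ((hF.clm_comp continuousOn_const).clm_comp continuousOn_const).sub
    ((hF.clm_comp continuousOn_const).clm_comp continuousOn_const)

end Field

end OMD

theorem mainTheorem3
    {V₁ V₂ : Type*}
    [NormedAddCommGroup V₁] [NormedSpace ℝ V₁] [FiniteDimensional ℝ V₁]
    [NormedAddCommGroup V₂] [NormedSpace ℝ V₂] [FiniteDimensional ℝ V₂]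
    -- the saddle-point problem
    (C₁ : Set V₁) (C₂ : Set V₂)
    (hC₁ : IsCompact C₁) (hC₁' : Convex ℝ C₁) (hC₂ : IsCompact C₂) (hC₂' : Convex ℝ C₂)
    (f : V₁ → V₂ → ℝ)
    (hf : ∀ x₁ ∈ C₁, ∀ x₂ ∈ C₂, ContDiffAt ℝ 1 (fun z : V₁ × V₂ => f z.1 z.2) (x₁, x₂))
    (hsol : ∃ p : OMD.Space V₁ V₂, OMD.IsSaddle f C₁ C₂ p)
    (hcoh : OMD.StrictlyCoherent f C₁ C₂)
    -- the distance-generating function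
    (K : ℝ) (h : OMD.Space V₁ V₂ → ℝ)
    (dh : OMD.Space V₁ V₂ → StrongDual ℝ (OMD.Space V₁ V₂))
    (hdgf : OMD.IsDGF (OMD.feasible C₁ C₂) K h dh)
    (hrec : OMD.BregmanReciprocity (OMD.feasible C₁ C₂) h dh)
    -- the step-sizes
    (γ : ℕ → ℝ) (hγ : ∀ n, 0 < γ n)
    (hγ_sum : Tendsto (fun N => ∑ n ∈ Finset.range N, γ n) atTop atTop)
    (hγ_sq : Summable (fun n => γ n ^ 2))
    -- the algorithm, run with a stochastic gradient oracle
    {Ω : Type*} {m0 : MeasurableSpace Ω} (P : Measure Ω) [IsProbabilityMeasure P]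
    (X Y : ℕ → Ω → OMD.Space V₁ V₂)
    (hX : ∀ n, StronglyMeasurable (X n)) (hY : ∀ n, StronglyMeasurable (Y n))
    (u v : ℕ → Ω → StrongDual ℝ (OMD.Space V₁ V₂))
    (homd : OMD.IsOMD (OMD.feasible C₁ C₂) h dh γ X Y u v)
    (G : ℝ)
    (hu : ∀ n, OMD.IsOracleSignal P (OMD.history X n) (OMD.gradField f) G (X n) (u n))
    (hv : ∀ n, OMD.IsOracleSignal P (OMD.halfHistory X Y n) (OMD.gradField f) G (Y n) (v n)) :
    ∀ᵐ ω ∂P, ∃ p : OMD.Space V₁ V₂, OMD.IsSaddle f C₁ C₂ p ∧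
      Tendsto (fun n => X n ω) atTop (𝓝 p) := by
  -- Coherence turns saddle points into solutions of the variational inequality, and `hcoh.2` makes
  -- it strict off the solution set.
  exact homd.ae_exists_tendsto (S := {p | OMD.IsSaddle f C₁ C₂ p}) hdgf
    (OMD.isCompact_feasible hC₁ hC₂) hrec (OMD.continuousOn_gradField hf) hγ hγ_sum hγ_sq hX hY
    hu hv hsol (fun p hp => hp.1) (fun p hp => ((hcoh.1 p).1 hp).2) hcoh.2
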